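/- Let $t \ge 3$ be an integer, let $n, d \ge 0$ be integers, and write $n = q(d+1)+r$ with integers $q \ge 0$ and $0 \le r \le d$. Then every finite simple graph on $n$ vertices with maximum degree at most $d$ (in particular, every one with maximum degree exactly $d$) has at most $$q\binom{d+1}{t} + \binom{r}{t}$$ cliques of size $t$, where a clique of size $t$ is a set of $t$ pairwise adjacent vertices. -/

import Mathlib

/-! Some closed neighbourhood N[v] meets at most C(|N[v]|, t) t-cliques; delete it, induct, and
merge blocks by convexity of binomials. Such a v exists by averaging
(`sum_card_isClique_meeting_le`): a t-clique K containing v lies in N[v], while pairs with v ∉ K are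
compared inside each (t+1)-set K ∪ {v} (`card_filter_isClique_erase_le`). -/

namespace Nat

/-- The increments of `x ↦ x.choose t` over a step `k` are monotone. -/
theorem choose_add_add_choose_le {s r : ℕ} (h : s ≤ r) (k t : ℕ) :
    (s + k).choose t + r.choose t ≤ (r + k).choose t + s.choose t := by
  cases t with
  | zero => simp
  | succ t =>
    induction k with
    | zero => simp [add_comm]
    | succ k ih =>
      have := Nat.choose_le_choose t (Nat.add_le_add_right h k)
      rw [← add_assoc, ← add_assoc, Nat.choose_succ_succ' (s + k), Nat.choose_succ_succ' (r + k)]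
      omega

/-- The number of `t`-subsets in a partition of `m` points into blocks of size `D` and a
remainder does not decrease when a further block of size `a ≤ D` is merged in. -/
theorem choose_add_div_mul_choose_le {a D m t : ℕ} (ht : 0 < t) (hD : 0 < D) (ha : a ≤ D) :
    a.choose t + (m / D * D.choose t + (m % D).choose t) ≤
      (a + m) / D * D.choose t + ((a + m) % D).choose t := by
  have hr : m % D < D := Nat.mod_lt m hD
  have hm := Nat.div_add_mod m D
  generalize m / D = q at hm ⊢
  generalize m % D = r at hm hr ⊢
  subst hm
  rcases lt_or_ge (a + r) D with hlt | hge
  · have h1 : a + (D * q + r) = (a + r) + D * q := by ring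
    rw [h1, Nat.add_mul_div_left _ _ hD, Nat.add_mul_mod_self_left, Nat.div_eq_of_lt hlt,
      Nat.mod_eq_of_lt hlt]
    have := choose_add_add_choose_le (Nat.zero_le r) a t
    rw [Nat.choose_eq_zero_of_lt ht, zero_add, Nat.add_comm r a] at this
    rw [zero_add q]
    omega
  · obtain ⟨s, hs⟩ := Nat.exists_eq_add_of_le hge
    have hsD : s < D := by omega
    have h1 : a + (D * q + r) = s + D * (q + 1) := by
      rw [Nat.mul_add]; omega
    rw [h1, Nat.add_mul_div_left _ _ hD, Nat.add_mul_mod_self_left, Nat.div_eq_of_lt hsD,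
      Nat.mod_eq_of_lt hsD]
    -- Overflow: a + r = D + s, so the sizes a, r spread out to D, s with the same sum.
    have h := choose_add_add_choose_le (show s ≤ r by omega) (a - s) t
    rw [show s + (a - s) = a by omega, show r + (a - s) = D by omega] at h
    rw [zero_add, Nat.add_mul]
    omega

end Nat

namespace Finset

variable {V : Type*} [DecidableEq V]

/-- Pairs of a point and a `t`-set avoiding it correspond to pointed `(t + 1)`-sets. -/
theorem sum_card_filter_notMem_powersetCard (S : Finset V) (t : ℕ) (P : V → Finset V → Prop)
    [∀ v, DecidablePred (P v)] :
    ∑ v ∈ S, #{K ∈ S.powersetCard t | P v K ∧ v ∉ K} =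
      ∑ W ∈ S.powersetCard (t + 1), #{v ∈ W | P v (W.erase v)} := by
  rw [← card_sigma, ← card_sigma]
  refine card_nbij' (fun p => ⟨insert p.1 p.2, p.1⟩) (fun p => ⟨p.2, p.1.erase p.2⟩) ?_ ?_ ?_ ?_
  · rintro ⟨v, K⟩ h
    simp only [coe_sigma, Set.mem_sigma_iff, mem_coe, mem_filter, mem_powersetCard] at h ⊢
    obtain ⟨hv, ⟨hKS, hK⟩, hP, hvK⟩ := h
    exact ⟨⟨insert_subset hv hKS, by rw [card_insert_of_notMem hvK, hK]⟩, mem_insert_self _ _,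
      by rwa [erase_insert hvK]⟩
  · rintro ⟨W, v⟩ h
    simp only [coe_sigma, Set.mem_sigma_iff, mem_coe, mem_filter, mem_powersetCard] at h ⊢
    obtain ⟨⟨hWS, hW⟩, hv, hP⟩ := h
    exact ⟨hWS hv, ⟨(erase_subset _ _).trans hWS, by rw [card_erase_of_mem hv, hW]; rfl⟩, hP,
      notMem_erase _ _⟩
  · rintro ⟨v, K⟩ h
    simp only [coe_sigma, Set.mem_sigma_iff, mem_coe, mem_filter] at h
    simp [erase_insert h.2.2.2]
  · rintro ⟨W, v⟩ h
    simp only [coe_sigma, Set.mem_sigma_iff, mem_coe, mem_filter] at h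
    simp [insert_erase h.2.1]

end Finset

namespace SimpleGraph

open Finset

variable {V : Type*} [DecidableEq V] (G : SimpleGraph V) [DecidableRel G.Adj]

/-- In a set `W` of at least four vertices, the vertices `v` with a neighbour in `W` whose removal
leaves a clique are at most as many as the vertices adjacent to all the others. -/
theorem card_filter_isClique_erase_le {W : Finset V} (hW : 4 ≤ #W) :
    #{v ∈ W | G.IsClique (W.erase v : Finset V) ∧ ∃ u ∈ W.erase v, u = v ∨ G.Adj v u} ≤
      #{v ∈ W | ∀ u ∈ W.erase v, u = v ∨ G.Adj v u} := by
  set L := {v ∈ W | G.IsClique (W.erase v : Finset V) ∧ ∃ u ∈ W.erase v, u = v ∨ G.Adj v u}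
  set U := {v ∈ W | ∀ u ∈ W.erase v, u = v ∨ G.Adj v u}
  by_cases hLU : L ⊆ U
  · exact card_le_card hLU
  obtain ⟨v, hvL, hvU⟩ := not_subset.1 hLU
  obtain ⟨hvW, hvc, u, huv, hvu⟩ := mem_filter.1 hvL
  obtain ⟨w, hw, hwv, hnad⟩ : ∃ w ∈ W, w ≠ v ∧ ¬ G.Adj v w := by
    by_contra! hcon
    exact hvU (mem_filter.2 ⟨hvW, fun x hx =>
      Or.inr (hcon x (mem_of_mem_erase hx) (ne_of_mem_erase hx))⟩)
  -- Removing any other vertex leaves the non-adjacent pair v, w.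
  have hsub : L ⊆ {v, w} := by
    intro x hx
    by_contra hxvw
    simp only [mem_insert, mem_singleton, not_or] at hxvw
    obtain ⟨-, hxc, -⟩ := mem_filter.1 hx
    exact hnad (hxc (mem_coe.2 (mem_erase.2 ⟨Ne.symm hxvw.1, hvW⟩)) (mem_coe.2 (mem_erase.2 ⟨Ne.symm hxvw.2, hw⟩))
      hwv.symm)
  have huni : ∀ x ∈ W, x ≠ v → G.Adj v x → x ∈ U := by
    intro x hx hxv hadj
    refine mem_filter.2 ⟨hx, fun y hy => Or.inr ?_⟩
    rcases eq_or_ne y v with rfl | hyv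
    · exact hadj.symm
    · exact hvc (mem_coe.2 (mem_erase.2 ⟨hxv, hx⟩)) (mem_coe.2 (mem_erase.2 ⟨hyv, mem_of_mem_erase hy⟩))
        (ne_of_mem_erase hy).symm
  by_cases hwL : w ∈ L
  · obtain ⟨-, hwc, -⟩ := mem_filter.1 hwL
    -- Now v and w are the only non-adjacent pair, so |U| ≥ |W| - 2 ≥ 2 ≥ |L|; this is where t ≥ 3
    -- is needed.
    have hsubU : (W.erase v).erase w ⊆ U := by
      intro x hx
      simp only [mem_erase] at hx
      exact huni x hx.2.2 hx.2.1 (hwc (mem_coe.2 (mem_erase.2 ⟨hwv.symm, hvW⟩))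
        (mem_coe.2 (mem_erase.2 ⟨hx.1, hx.2.2⟩)) hx.2.1.symm)
    have h1 := card_le_card hsubU
    rw [card_erase_of_mem (mem_erase.2 ⟨hwv, hw⟩), card_erase_of_mem hvW] at h1
    have h2 := (card_le_card hsub).trans card_le_two
    omega
  · have hsub' : L ⊆ {v} := by
      intro x hx
      rcases mem_insert.1 (hsub hx) with h | h
      · exact mem_singleton.2 h
      · exact absurd (mem_singleton.1 h ▸ hx) hwL
    have huU : u ∈ U :=
      huni u (mem_of_mem_erase huv) (ne_of_mem_erase huv) (hvu.resolve_left (ne_of_mem_erase huv))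
    exact (card_le_card hsub').trans (by simpa using card_pos.2 ⟨u, huU⟩)

/-- On average over the vertices `v` of `S`, at most as many `t`-cliques of `S` meet the closed
neighbourhood of `v` as this neighbourhood has `t`-subsets. -/
theorem sum_card_isClique_meeting_le (S : Finset V) {t : ℕ} (ht : 3 ≤ t) :
    ∑ v ∈ S, #{K ∈ S.powersetCard t | G.IsClique (K : Finset V) ∧ ∃ u ∈ K, u = v ∨ G.Adj v u} ≤
      ∑ v ∈ S, (#{u ∈ S | u = v ∨ G.Adj v u}).choose t := by
  have hchoose : ∀ v, (#{u ∈ S | u = v ∨ G.Adj v u}).choose t =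
      #{K ∈ S.powersetCard t | ∀ u ∈ K, u = v ∨ G.Adj v u} := by
    intro v
    rw [← card_powersetCard]
    congr 1
    ext K
    simp only [mem_powersetCard, mem_filter, subset_iff]
    grind
  simp only [hchoose]
  have hsplit : ∀ (v : V) (P : Finset V → Prop) [DecidablePred P],
      #{K ∈ S.powersetCard t | P K} =
        #{K ∈ S.powersetCard t | P K ∧ v ∈ K} + #{K ∈ S.powersetCard t | P K ∧ v ∉ K} := by
    intro v P _
    rw [← filter_filter, ← filter_filter, card_filter_add_card_filter_not]
  rw [sum_congr rfl fun v _ => hsplit v _, sum_congr rfl fun v _ => hsplit v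
    (fun K => ∀ u ∈ K, u = v ∨ G.Adj v u), sum_add_distrib, sum_add_distrib,
    sum_card_filter_notMem_powersetCard S t
      (fun v K => G.IsClique (K : Finset V) ∧ ∃ u ∈ K, u = v ∨ G.Adj v u),
    sum_card_filter_notMem_powersetCard S t (fun v K => ∀ u ∈ K, u = v ∨ G.Adj v u)]
  -- The case v ∈ K holds for each v separately; the case v ∉ K only after regrouping by W = K ∪
  -- {v}.
  refine Nat.add_le_add (sum_le_sum fun v _ => card_le_card fun K hK => ?_)
    (sum_le_sum fun W hW => G.card_filter_isClique_erase_le ?_)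
  · obtain ⟨hKS, ⟨hc, -⟩, hvK⟩ := mem_filter.1 hK
    refine mem_filter.2 ⟨hKS, fun u hu => ?_, hvK⟩
    exact or_iff_not_imp_left.2 fun huv => hc hvK hu (Ne.symm huv)
  · rw [(mem_powersetCard.1 hW).2]
    omega

/-- If every closed neighbourhood has at most `D` vertices, then a set of `m` vertices contains at
most as many `t`-cliques as a disjoint union of copies of `K_D` and one smaller clique. -/
theorem card_isClique_powersetCard_le {D t : ℕ} (hD : 0 < D) (ht : 3 ≤ t)
    (hdeg : ∀ (S : Finset V) (v : V), #{u ∈ S | u = v ∨ G.Adj v u} ≤ D) (S : Finset V) :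
    #{K ∈ S.powersetCard t | G.IsClique (K : Finset V)} ≤
      #S / D * D.choose t + (#S % D).choose t := by
  induction S using Finset.strongInduction with
  | H S ih =>
    rcases S.eq_empty_or_nonempty with rfl | hS
    · rw [powersetCard_eq_empty.2 (by simpa using (by omega : 0 < t))]
      simp
    obtain ⟨v, hv, hle⟩ := exists_le_of_sum_le hS (G.sum_card_isClique_meeting_le S ht)
    set N := {u ∈ S | u = v ∨ G.Adj v u} with hN
    have hNS : N ⊆ S := filter_subset _ _
    have hvN : v ∈ N := mem_filter.2 ⟨hv, Or.inl rfl⟩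
    have hrec := ih (S \ N) (sdiff_ssubset hNS ⟨v, hvN⟩)
    -- A clique of S that does not meet N lies in S \ N.
    have hcover : {K ∈ S.powersetCard t | G.IsClique (K : Finset V)} ⊆
        {K ∈ S.powersetCard t | G.IsClique (K : Finset V) ∧ ∃ u ∈ K, u = v ∨ G.Adj v u} ∪
          {K ∈ (S \ N).powersetCard t | G.IsClique (K : Finset V)} := by
      intro K hK
      obtain ⟨hKS, hc⟩ := mem_filter.1 hK
      by_cases hm : ∃ u ∈ K, u = v ∨ G.Adj v u
      · exact mem_union_left _ (mem_filter.2 ⟨hKS, hc, hm⟩)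
      · refine mem_union_right _ (mem_filter.2 ⟨mem_powersetCard.2 ⟨fun u hu => ?_, ?_⟩, hc⟩)
        · exact mem_sdiff.2 ⟨(mem_powersetCard.1 hKS).1 hu,
            fun huN => hm ⟨u, hu, (mem_filter.1 huN).2⟩⟩
        · exact (mem_powersetCard.1 hKS).2
    have hcard := (card_le_card hcover).trans (card_union_le _ _)
    have hmerge := Nat.choose_add_div_mul_choose_le (m := #(S \ N)) (t := t) (by omega) hD
      (hdeg S v)
    rw [← hN, add_comm #N, card_sdiff_add_card_eq_card hNS] at hmerge
    omega

end SimpleGraph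

theorem theorem2 (t : ℕ) (ht : 3 ≤ t) (n d q r : ℕ) (hr : r ≤ d) (hn : n = q * (d + 1) + r)
    {V : Type*} [Fintype V] [DecidableEq V] (hV : Fintype.card V = n)
    (G : SimpleGraph V) [DecidableRel G.Adj] (hG : G.maxDegree ≤ d) :
    (G.cliqueFinset t).card ≤ q * (d + 1).choose t + r.choose t := by
  have hdeg : ∀ (S : Finset V) (v : V), (S.filter fun u => u = v ∨ G.Adj v u).card ≤ d + 1 := by
    intro S v
    have hsub : (S.filter fun u => u = v ∨ G.Adj v u) ⊆ insert v (G.neighborFinset v) := by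
      intro u hu
      simpa using (Finset.mem_filter.1 hu).2
    refine (Finset.card_le_card hsub).trans ((Finset.card_insert_le _ _).trans ?_)
    exact Nat.add_le_add_right ((G.degree_le_maxDegree v).trans hG) 1
  have h := G.card_isClique_powersetCard_le d.succ_pos ht hdeg Finset.univ
  have hcliques : G.cliqueFinset t =
      (Finset.univ.powersetCard t).filter fun K : Finset V => G.IsClique K := by
    ext K
    simp [SimpleGraph.mem_cliqueFinset_iff, SimpleGraph.isNClique_iff, Finset.mem_powersetCard,
      and_comm]
  have hdiv : n / (d + 1) = q := by
    rw [hn, Nat.mul_comm, Nat.mul_add_div d.succ_pos, Nat.div_eq_of_lt (by omega), add_zero]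
  have hmod : n % (d + 1) = r := by
    rw [hn, Nat.mul_comm, Nat.mul_add_mod, Nat.mod_eq_of_lt (by omega)]
  rwa [Finset.card_univ, hV, Nat.succ_eq_add_one, hdiv, hmod, ← hcliques] at h
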